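/- Let $\mathbf{ON}$ be the class of all ordinals, and let $\Bbbk\colon(\mathbf{ON},\le)\to\mathsf{Fields}$, $\alpha\mapsto\Bbbk_\alpha$, be a functor such that the field extension $\Bbbk_\alpha\to\Bbbk_\beta$ has infinite degree whenever $\alpha<\beta$. Let $\mathcal C_\Bbbk$ be the following category. Its objects are the tuples $V=(V_\alpha)_{\alpha\in\mathbf{ON}}$ of $\Bbbk_\alpha$-vector spaces with $\Bbbk_\alpha$-linear transition maps $\nu_{\beta\alpha}\colon V_\alpha\to V_\beta$ for $\alpha\le\beta$, satisfying $\nu_{\alpha\alpha}=\mathrm{id}$ and $\nu_{\gamma\beta}\nu_{\beta\alpha}=\nu_{\gamma\alpha}$, that are *grounded*: there is an ordinal $\alpha$ such that for every $\beta>\alpha$ the space $V_\beta$ is the $\Bbbk_\beta$-linear span of $\nu_{\beta\alpha}(V_\alpha)$. Its morphisms $V\to W$ are the families of $\Bbbk_\alpha$-linear maps $V_\alpha\to W_\alpha$ that commute with the transition maps. For a category $\mathcal C$ with zero morphisms, let $\mathcal C\triangleleft\mathsf{Set}$ be the category whose objects are the triples $(c,S,f)$ with $c\in\mathcal C$, $S$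 a set and $f\colon S\to\mathcal C(c,c)$ a function, and whose morphisms $(c,S,f)\to(c',S',f')$ are the $\psi\in\mathcal C(c,c')$ with $\psi\circ f(s)=f'(s)\circ\psi$ for all $s\in S\cup S'$, where $f(s):=0$ for $s\notin S$ and $f'(s):=0$ for $s\notin S'$. Then $\mathcal C_\Bbbk\triangleleft\mathsf{Set}$ is an abelian category (with hom-sets that are sets, not proper classes) and is AB5, that is, it has all small colimits and its small filtered colimits are exact. It does not have all countable products (i.e. products indexed by $\aleph_0$). Every injective object and every projective object of $\mathcal C_\Bbbk\triangleleft\mathsf{Set}$ is a zero object. -/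

import Mathlib

open CategoryTheory CategoryTheory.Limits

universe u v w

/-- A functor from the (large) poset of ordinals to fields. The universe `u` plays the role of the
universe of sets, so that `Ordinal.{u}` is the proper class of all ordinals and the fields are
sets. -/
structure FieldTower where
  K : Ordinal.{u} → Type u
  [field : ∀ α, Field (K α)]
  map : ∀ {α β : Ordinal.{u}}, α ≤ β → K α →+* K β
  map_refl : ∀ (α : Ordinal.{u}) (x : K α), map (le_refl α) x = x
  map_map : ∀ {α β γ : Ordinal.{u}} (hαβ : α ≤ β) (hβγ : β ≤ γ) (x : K α),
    map hβγ (map hαβ x) = map (hαβ.trans hβγ) x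

attribute [instance] FieldTower.field

/-- Each extension `K α → K β` with `α < β` has infinite degree. -/
def FieldTower.IsInfinite (k : FieldTower.{u}) : Prop :=
  ∀ ⦃α β : Ordinal.{u}⦄ (h : α < β), ¬ (k.map h.le).Finite

/-- An arbitrary ordinal-indexed tuple of `K α`-vector spaces with compatible transition maps.
The transition map `ν h : V α → V β` is `K α`-linear, where `K α` acts on `V β` through
`K α → K β`. -/
structure TowerRep (k : FieldTower.{u}) where
  V : Ordinal.{u} → Type u
  [addCommGroup : ∀ α, AddCommGroup (V α)]
  [module : ∀ α, Module (k.K α) (V α)]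
  ν : ∀ {α β : Ordinal.{u}} (h : α ≤ β), V α →ₛₗ[k.map h] V β
  ν_refl : ∀ (α : Ordinal.{u}) (x : V α), ν (le_refl α) x = x
  ν_ν : ∀ {α β γ : Ordinal.{u}} (hαβ : α ≤ β) (hβγ : β ≤ γ) (x : V α),
    ν hβγ (ν hαβ x) = ν (hαβ.trans hβγ) x

attribute [instance] TowerRep.addCommGroup TowerRep.module

namespace TowerRep

variable {k : FieldTower.{u}}

@[ext]
structure Hom (X Y : TowerRep k) where
  app : ∀ α : Ordinal.{u}, X.V α →ₗ[k.K α] Y.V α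
  naturality : ∀ {α β : Ordinal.{u}} (h : α ≤ β) (x : X.V α),
    app β (X.ν h x) = Y.ν h (app α x)

instance : Category (TowerRep k) where
  Hom X Y := Hom X Y
  id X := { app := fun _ => LinearMap.id, naturality := fun _ _ => rfl }
  comp f g :=
    { app := fun α => (g.app α).comp (f.app α)
      naturality := fun h x => by simp [f.naturality h, g.naturality h] }

@[ext]
theorem hom_ext {X Y : TowerRep k} {f g : X ⟶ Y} (h : ∀ α, Hom.app f α = Hom.app g α) : f = g :=
  Hom.ext (funext h)

@[simp]
theorem id_app (X : TowerRep k) (α : Ordinal.{u}) : Hom.app (𝟙 X) α = LinearMap.id := rfl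

@[simp]
theorem comp_app {X Y Z : TowerRep k} (f : X ⟶ Y) (g : Y ⟶ Z) (α : Ordinal.{u}) :
    Hom.app (f ≫ g) α = (Hom.app g α).comp (Hom.app f α) := rfl

section Additive

variable (X Y : TowerRep k)

instance : Zero (X ⟶ Y) :=
  ⟨{ app := fun _ => 0, naturality := fun _ _ => by simp }⟩

instance : Add (X ⟶ Y) :=
  ⟨fun f g =>
    { app := fun α => Hom.app f α + Hom.app g α
      naturality := fun h x => by simp [Hom.naturality] }⟩

instance : Neg (X ⟶ Y) :=
  ⟨fun f =>
    { app := fun α => - Hom.app f α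
      naturality := fun h x => by simp [Hom.naturality] }⟩

@[simp]
theorem zero_app (α : Ordinal.{u}) : Hom.app (0 : X ⟶ Y) α = 0 := rfl

variable {X Y}

@[simp]
theorem add_app (f g : X ⟶ Y) (α : Ordinal.{u}) :
    Hom.app (f + g) α = Hom.app f α + Hom.app g α := rfl

@[simp]
theorem neg_app (f : X ⟶ Y) (α : Ordinal.{u}) : Hom.app (-f) α = - Hom.app f α := rfl

instance : AddCommGroup (X ⟶ Y) where
  add_assoc f g h := by ext α : 1; simp [add_assoc]
  zero_add f := by ext α : 1; simp
  add_zero f := by ext α : 1; simp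
  add_comm f g := by ext α : 1; simp [add_comm]
  neg_add_cancel f := by ext α : 1; simp
  nsmul := nsmulRec
  zsmul := zsmulRec

end Additive

instance : Preadditive (TowerRep k) where
  add_comp X Y Z f f' g := by ext α : 1; simp [LinearMap.comp_add]
  comp_add X Y Z f g g' := by ext α : 1; simp [LinearMap.add_comp]

/-- `V β` is spanned over `K β` by the image of `V α`, for all `β > α`. -/
def IsGroundedAt (X : TowerRep k) (α : Ordinal.{u}) : Prop :=
  ∀ ⦃β : Ordinal.{u}⦄ (h : α < β), Submodule.span (k.K β) (Set.range (X.ν h.le)) = ⊤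

/-- Being `α`-grounded for some ordinal `α`. -/
def IsGrounded (k : FieldTower.{u}) : ObjectProperty (TowerRep k) :=
  fun X => ∃ α : Ordinal.{u}, X.IsGroundedAt α

end TowerRep

/-- The category of grounded objects attached to a tower of fields: a full subcategory of the
category of all tuples. -/
abbrev GroundedRep (k : FieldTower.{u}) : Type (u + 1) :=
  (TowerRep.IsGrounded k).FullSubcategory

/-- A set-decorated object `(c, S, f)` of a category with zero morphisms: an object `c`, a set `S`
and a function `f` from `S` to the endomorphisms of `c`. Labels from different sets `S`, `S'` have
to be compared, so `S` is a set in the sense of set theory. -/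
structure SetDecorated (C : Type w) [Category.{v} C] where
  obj : C
  labels : ZFSet.{u}
  endo : {s : ZFSet.{u} // s ∈ labels} → (obj ⟶ obj)

namespace SetDecorated

variable {C : Type w} [Category.{v} C] [HasZeroMorphisms C]

open Classical in
/-- The function `f` of `(c, S, f)`, extended by zero to all labels. -/
noncomputable def act (X : SetDecorated.{u} C) (s : ZFSet.{u}) : X.obj ⟶ X.obj :=
  if h : s ∈ X.labels then X.endo ⟨s, h⟩ else 0

theorem act_of_notMem (X : SetDecorated.{u} C) {s : ZFSet.{u}} (h : s ∉ X.labels) :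
    X.act s = 0 := dif_neg h

@[ext]
structure Hom (X Y : SetDecorated.{u} C) where
  hom : X.obj ⟶ Y.obj
  comm : ∀ s ∈ X.labels ∪ Y.labels, X.act s ≫ hom = hom ≫ Y.act s

theorem Hom.comm_all {X Y : SetDecorated.{u} C} (f : Hom X Y) (s : ZFSet.{u}) :
    X.act s ≫ f.hom = f.hom ≫ Y.act s := by
  by_cases hs : s ∈ X.labels ∪ Y.labels
  · exact f.comm s hs
  · rw [ZFSet.mem_union, not_or] at hs
    rw [X.act_of_notMem hs.1, Y.act_of_notMem hs.2, zero_comp, comp_zero]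

noncomputable instance : Category (SetDecorated.{u} C) where
  Hom X Y := Hom X Y
  id X := { hom := 𝟙 X.obj, comm := fun s _ => by simp }
  comp f g :=
    { hom := f.hom ≫ g.hom
      comm := fun s _ => by
        rw [← Category.assoc, f.comm_all, Category.assoc, g.comm_all, Category.assoc] }
  id_comp f := Hom.ext (Category.id_comp f.hom)
  comp_id f := Hom.ext (Category.comp_id f.hom)
  assoc f g h := Hom.ext (Category.assoc f.hom g.hom h.hom)

end SetDecorated

/-! A decorated grounded object is a family of abelian groups on which scalars, transition maps and
words in labels act, that is, a functor from `OpCat k` to abelian groups. This embeds the category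
fully faithfully, with image the functors satisfying `IsDecoratedGrounded`. These are closed under
quotients, small colimits and finite products, since each condition can be tested on a jointly
epimorphic small family, the ordinal and the label set being enlarged to a supremum and a union.
Once they are also closed under kernels, the subcategory is abelian and inherits exactness of
filtered colimits.

Closure under kernels is the substantial point (`exists_ker_le_span`). For a grounded target `Y`
there is a stage `α` at which a basis of `Y.V α` stays independent at all later stages, because `Y.V
α` has only a set of subsets, while the ordinals are unbounded. Then `k.K β ⊗ Y.V α → Y.V β` is
injective, and flatness of field extensions shows that the kernel at `β` is spanned by the kernel at
`α`.

Countable products fail because a product would carry an element at a stage `β > α` with coordinates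
linearly independent over `k.K α`, whereas an element spanned from stage `α` has all its coordinates
in one finite-dimensional `k.K α`-subspace of `k.K β`.

For injectives and projectives, every `X` has a label that it does not use. Letting that label act
on a double of `X` as a nilpotent shear gives a self-extension of `X` that splits only if `X` is
zero. -/

namespace TowerRep

/-! ### Grounded towers: persistent bases and kernels. -/

open TensorProduct

variable {k : FieldTower.{u}}

theorem IsGroundedAt.mono {X : TowerRep k} {α β : Ordinal.{u}} (hX : X.IsGroundedAt α)
    (h : α ≤ β) : X.IsGroundedAt β := by
  intro γ hγ
  rw [eq_top_iff, ← hX (h.trans_lt hγ)]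
  refine Submodule.span_mono ?_
  rintro _ ⟨x, rfl⟩
  exact ⟨X.ν h x, X.ν_ν _ _ _⟩

/-- A linear relation is carried along the transition maps, and its coefficients stay nonzero
because field maps are injective. Hence dependence, once it occurs, persists. -/
theorem linearIndependent_of_ν (X : TowerRep k) {α β : Ordinal.{u}} (h : α ≤ β) {ι : Type*}
    {v : ι → X.V α} (hv : LinearIndependent (k.K β) fun i => X.ν h (v i)) :
    LinearIndependent (k.K α) v := by
  rw [linearIndependent_iff'] at hv ⊢
  intro s g hg i hi
  have h0 := hv s (fun i => k.map h (g i)) (by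
    have := congrArg (X.ν h) hg
    simpa [map_sum] using this) i hi
  exact (map_eq_zero _).1 h0

/-- A grounded object eventually has a basis that stays linearly independent forever. -/
theorem IsGroundedAt.exists_basis {X : TowerRep k} {α : Ordinal.{u}} (hX : X.IsGroundedAt α) :
    ∃ β, α ≤ β ∧ ∃ (ι : Type u) (b : Module.Basis ι (k.K β) (X.V β)),
      ∀ ⦃γ : Ordinal.{u}⦄ (h : β ≤ γ), LinearIndependent (k.K γ) fun i => X.ν h (b i) := by
  classical
  let bad (T : Set (X.V α)) (γ : Ordinal.{u}) : Prop :=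
    ∃ h : α ≤ γ, ¬ LinearIndependent (k.K γ) fun t : T => X.ν h t
  -- A stage at which `T` has become dependent, or the harmless value `α` if this never happens. The
  -- supremum over all `T` exists because the subsets of `X.V α` form a small set.
  let g (T : Set (X.V α)) : Ordinal.{u} := if h : ∃ γ, bad T γ then h.choose else α
  have hg (T : Set (X.V α)) (γ) (h : bad T γ) : bad T (g T) := by
    have h' : ∃ γ, bad T γ := ⟨γ, h⟩
    simp only [g, dif_pos h']
    exact h'.choose_spec
  -- The successor makes `α < β` strict, as groundedness at `α` says nothing about `α` itself.
  let β := Order.succ (max α (⨆ T, g T))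
  have hgβ (T) : g T ≤ β :=
    ((le_ciSup (Ordinal.bddAbove_of_small (s := Set.range g)) T).trans (le_max_right _ _)).trans
      (Order.le_succ _)
  have hαβ : α < β := Order.lt_succ_of_le (le_max_left _ _)
  obtain ⟨ι, a, ha, hspan, hli⟩ := exists_linearIndependent' (k.K β) (X.ν hαβ.le)
  rw [hX hαβ] at hspan
  refine ⟨β, hαβ.le, ι, Module.Basis.mk hli hspan.ge, fun γ h => ?_⟩
  by_contra hcon
  have hbad : bad (Set.range a) γ := by
    refine ⟨hαβ.le.trans h, fun hT => hcon ?_⟩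
    rw [← linearIndependent_equiv (Equiv.ofInjective a ha)] at hT
    convert hT using 2 with i
    simp [X.ν_ν]
  -- A later dependence would already be visible at `g (Set.range a) ≤ β`, hence at `β`, where the
  -- family is a basis.
  obtain ⟨h1, h2⟩ := hg _ _ hbad
  apply h2
  apply X.linearIndependent_of_ν (hgβ (Set.range a))
  rw [← linearIndependent_equiv (Equiv.ofInjective a ha)]
  convert hli using 1
  funext i
  simp [X.ν_ν]

/-- The kernel of a morphism of grounded objects is grounded. -/
theorem exists_ker_le_span {X Y : TowerRep k} (hX : IsGrounded k X) (hY : IsGrounded k Y)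
    (f : X ⟶ Y) : ∃ α : Ordinal.{u}, ∀ ⦃β : Ordinal.{u}⦄ (h : α < β) (x : X.V β),
      Hom.app f β x = 0 →
        x ∈ Submodule.span (k.K β) (X.ν h.le '' {y | Hom.app f α y = 0}) := by
  obtain ⟨α₁, h₁⟩ := hX
  obtain ⟨α₂, h₂⟩ := hY
  obtain ⟨α, hα, ι, b, hb⟩ := (h₂.mono (le_max_right α₁ α₂)).exists_basis
  have hXα : X.IsGroundedAt α := h₁.mono ((le_max_left _ _).trans hα)
  refine ⟨α, fun β h x hx => ?_⟩
  let : Algebra (k.K α) (k.K β) := (k.map h.le).toAlgebra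
  let (Z : TowerRep k) : Module (k.K α) (Z.V β) := Module.compHom _ (k.map h.le)
  have (Z : TowerRep k) : IsScalarTower (k.K α) (k.K β) (Z.V β) :=
    ⟨fun r s z => mul_smul (k.map h.le r) s z⟩
  let ν' (Z : TowerRep k) : Z.V α →ₗ[k.K α] Z.V β :=
    { toFun := Z.ν h.le
      map_add' := map_add _
      map_smul' := fun r z => (Z.ν h.le).map_smulₛₗ r z }
  let μ (Z : TowerRep k) : k.K β ⊗[k.K α] Z.V α →ₗ[k.K β] Z.V β := (ν' Z).liftBaseChange (k.K β)
  have hμ (Z : TowerRep k) (c : k.K β) (z : Z.V α) : μ Z (c ⊗ₜ z) = c • Z.ν h.le z := by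
    simp [μ, ν']
  have hnat (t) : Hom.app f β (μ X t) = μ Y ((Hom.app f α).lTensor (k.K β) t) := by
    induction t with
    | zero => simp
    | add s t hs ht => simp [hs, ht]
    | tmul c z => simp [hμ, f.naturality]
  have hsurj : x ∈ LinearMap.range (μ X) := by
    have : Submodule.span (k.K β) (Set.range (X.ν h.le)) ≤ LinearMap.range (μ X) := by
      rw [Submodule.span_le]
      rintro _ ⟨z, rfl⟩
      exact ⟨1 ⊗ₜ z, by simp [hμ]⟩
    rw [hXα h] at this
    exact this trivial
  obtain ⟨t, rfl⟩ := hsurj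
  -- The base-changed basis is sent to the transported basis, which is still independent at `β`.
  have hinj : Function.Injective (μ Y) := by
    refine (injective_iff_map_eq_zero (μ Y)).2 fun y hy => ?_
    have hli : LinearIndependent (k.K β) (μ Y ∘ b.baseChange (k.K β)) := by
      convert hb h.le using 1
      funext i
      simp [hμ]
    rw [← (b.baseChange (k.K β)).linearCombination_repr y, Finsupp.apply_linearCombination] at hy
    exact (b.baseChange (k.K β)).repr.map_eq_zero_iff.1 (linearIndependent_iff.1 hli _ hy)
  have ht : (Hom.app f α).lTensor (k.K β) t = 0 := hinj (by rw [← hnat, hx, map_zero])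
  -- By flatness, `t` comes from `k.K β ⊗ ker (f_α)`.
  obtain ⟨s, rfl⟩ := (Module.Flat.lTensor_exact (k.K β)
    (LinearMap.exact_subtype_ker_map (Hom.app f α)) t).1 ht
  clear hx ht
  induction s with
  | zero => simp
  | add s t hs ht => simpa only [map_add] using Submodule.add_mem _ hs ht
  | tmul c z =>
    simp only [LinearMap.lTensor_tmul, hμ]
    exact Submodule.smul_mem _ _ (Submodule.subset_span ⟨_, z.2, rfl⟩)

end TowerRep

/-! ### Decorated grounded objects as functors: the conditions and their closure properties. -/

/-- The ordinals, as objects of the category whose morphisms encode the operations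
on a set-decorated grounded object: scalars, transition maps and words in the labels. -/
structure OpCat (k : FieldTower.{u}) where
  ord : Ordinal.{u}

namespace OpCat

variable {k : FieldTower.{u}}

@[ext]
structure Hom (a b : OpCat k) where
  le : a.ord ≤ b.ord
  coeff : k.K b.ord
  word : FreeMonoid ZFSet.{u}

instance : Category (OpCat k) where
  Hom := Hom
  id a := ⟨le_rfl, 1, 1⟩
  comp f g := ⟨f.le.trans g.le, g.coeff * k.map g.le f.coeff, g.word * f.word⟩
  id_comp f := Hom.ext (by simp) (by simp)
  comp_id f := Hom.ext (by simp [k.map_refl]) (by simp)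
  assoc f g h := Hom.ext (by simp [k.map_map, mul_assoc]) (by simp [mul_assoc])

/-- The morphism that applies the word `w`, then the transition map, then the scalar `c`. -/
def mkHom {α β : Ordinal.{u}} (h : α ≤ β) (c : k.K β) (w : FreeMonoid ZFSet.{u}) :
    (⟨α⟩ : OpCat k) ⟶ ⟨β⟩ := Hom.mk h c w

theorem id_eq (a : OpCat k) : 𝟙 a = mkHom le_rfl 1 1 := rfl

theorem mkHom_comp {α β γ : Ordinal.{u}} (h : α ≤ β) (h' : β ≤ γ) (c : k.K β) (c' : k.K γ)
    (w w' : FreeMonoid ZFSet.{u}) :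
    mkHom h c w ≫ mkHom h' c' w' = mkHom (k := k) (h.trans h') (c' * k.map h' c) (w' * w) := rfl

theorem map_mkHom_map_mkHom {α β γ : Ordinal.{u}} (h : α ≤ β) (h' : β ≤ γ) (c : k.K β) (c' : k.K γ)
    (w w' : FreeMonoid ZFSet.{u}) (G : OpCat k ⥤ AddCommGrpCat.{u}) (x : G.obj ⟨α⟩) :
    G.map (mkHom h' c' w') (G.map (mkHom h c w) x) =
      G.map (mkHom (h.trans h') (c' * k.map h' c) (w' * w)) x := by
  rw [← mkHom_comp, G.map_comp]; rfl

/-- The functors that come from set-decorated grounded objects. -/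
structure IsDecoratedGrounded (G : OpCat k ⥤ AddCommGrpCat.{u}) : Prop where
  map_add_coeff : ∀ (α : Ordinal.{u}) (c c' : k.K α),
    G.map (mkHom (le_refl α) (c + c') 1) = G.map (mkHom le_rfl c 1) + G.map (mkHom le_rfl c' 1)
  exists_labels : ∃ S : ZFSet.{u}, ∀ s ∉ S, ∀ α : Ordinal.{u},
    G.map (mkHom (le_refl α) 1 (FreeMonoid.of s)) = 0
  exists_ground : ∃ α : Ordinal.{u}, ∀ (β : Ordinal.{u}) (h : α < β) (Z : AddCommGrpCat.{u})
    (p : G.obj ⟨β⟩ ⟶ Z), (∀ c, G.map (mkHom h.le c 1) ≫ p = 0) → p = 0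

variable (k) in
def decoratedGrounded : ObjectProperty (OpCat k ⥤ AddCommGrpCat.{u}) := IsDecoratedGrounded

/-- Equalities of maps out of `G` can be checked after precomposition with the jointly epimorphic `q
j`. Smallness of `J` provides the union of the label sets and the supremum of the grounding
ordinals. -/
theorem IsDecoratedGrounded.of_jointly_epi {J : Type u} {G : OpCat k ⥤ AddCommGrpCat.{u}}
    (F : J → OpCat k ⥤ AddCommGrpCat.{u}) (hF : ∀ j, IsDecoratedGrounded (F j))
    (q : ∀ j, F j ⟶ G) (hq : ∀ (a : OpCat k) (Z : AddCommGrpCat.{u}) (p : G.obj a ⟶ Z),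
      (∀ j, (q j).app a ≫ p = 0) → p = 0) : IsDecoratedGrounded G where
  map_add_coeff α c c' := by
    rw [← sub_eq_zero]
    refine hq _ _ _ fun j => ?_
    simp only [Preadditive.comp_sub, Preadditive.comp_add, ← (q j).naturality,
      (hF j).map_add_coeff, Preadditive.add_comp, sub_self]
  exists_labels := by
    choose S hS using fun j => (hF j).exists_labels
    refine ⟨ZFSet.iUnion S, fun s hs α => hq _ _ _ fun j => ?_⟩
    rw [← (q j).naturality, hS j s (fun h => hs (ZFSet.mem_iUnion.2 ⟨j, h⟩)), zero_comp]
  exists_ground := by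
    choose α hα using fun j => (hF j).exists_ground
    refine ⟨⨆ j, α j, fun β h Z p hp => hq _ _ _ fun j => ?_⟩
    have hj : α j ≤ ⨆ j, α j := le_ciSup Ordinal.bddAbove_of_small j
    refine hα j β (hj.trans_lt h) _ _ fun c => ?_
    have : mkHom (hj.trans_lt h).le c 1 = mkHom hj 1 1 ≫ mkHom (k := k) h.le c 1 := by
      rw [mkHom_comp]; simp
    rw [← Category.assoc, (q j).naturality, this, G.map_comp, Category.assoc, Category.assoc, hp,
      comp_zero, comp_zero]

instance : (decoratedGrounded k).IsClosedUnderQuotients where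
  prop_of_epi q _ hX := by
    refine IsDecoratedGrounded.of_jointly_epi (J := PUnit) _ (fun _ => hX) (fun _ => q) ?_
    intro a Z p hp
    exact zero_of_epi_comp (q.app a) (hp ⟨⟩)

instance (J : Type u) [Category.{u} J] : (decoratedGrounded k).IsClosedUnderColimitsOfShape J where
  colimitsOfShape_le := by
    rintro G ⟨p⟩
    refine IsDecoratedGrounded.of_jointly_epi _ p.prop_diag_obj (fun j => p.ι.app j) ?_
    intro a Z q hq
    refine (isColimitOfPreserves ((evaluation _ _).obj a) p.isColimit).hom_ext fun j => ?_
    rw [comp_zero]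
    exact hq j

open ZeroObject in
instance : (decoratedGrounded k).ContainsZero where
  exists_zero := by
    refine ⟨0, isZero_zero _, ?_⟩
    refine IsDecoratedGrounded.of_jointly_epi (J := PEmpty) (fun j => j.elim) (fun j => j.elim)
      (fun j => j.elim) ?_
    intro a Z p _
    exact ((isZero_zero (OpCat k ⥤ AddCommGrpCat.{u})).obj a).eq_zero_of_src p

theorem IsDecoratedGrounded.biprod {F G : OpCat k ⥤ AddCommGrpCat.{u}}
    (hF : IsDecoratedGrounded F) (hG : IsDecoratedGrounded G) : IsDecoratedGrounded (F ⊞ G) := by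
  refine of_jointly_epi (J := ULift Bool) (fun j => bif j.down then F else G)
    (by rintro ⟨_ | _⟩ <;> assumption)
    (fun j => match j with
      | ⟨true⟩ => biprod.inl
      | ⟨false⟩ => biprod.inr) ?_
  intro a Z p hp
  have h1 : (biprod.inl : F ⟶ F ⊞ G).app a ≫ p = 0 := hp ⟨true⟩
  have h2 : (biprod.inr : G ⟶ F ⊞ G).app a ≫ p = 0 := hp ⟨false⟩
  have h : p = (𝟙 (F ⊞ G) : F ⊞ G ⟶ F ⊞ G).app a ≫ p := by simp
  rw [h, ← biprod.total, NatTrans.app_add, NatTrans.comp_app, NatTrans.comp_app,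
    Preadditive.add_comp, Category.assoc, Category.assoc, h1, h2, comp_zero, comp_zero, add_zero]

instance : (decoratedGrounded k).IsClosedUnderBinaryProducts := by
  refine .mk' ?_
  rintro _ ⟨F, hF⟩
  exact (decoratedGrounded k).prop_of_iso
    (biprod.isoProd _ _ ≪≫ (HasLimit.isoOfNatIso (diagramIsoPair F)).symm)
    (IsDecoratedGrounded.biprod (hF ⟨.left⟩) (hF ⟨.right⟩))

instance : (decoratedGrounded k).IsClosedUnderFiniteProducts := .mk'

/-- The tower of vector spaces underlying a decorated grounded functor. -/
abbrev IsDecoratedGrounded.moduleObj {G : OpCat k ⥤ AddCommGrpCat.{u}} (hG : IsDecoratedGrounded G)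
    (α : Ordinal.{u}) : Module (k.K α) (G.obj ⟨α⟩) where
  smul c x := G.map (mkHom le_rfl c 1) x
  one_smul x := by
    change G.map (𝟙 _) x = x
    simp
  mul_smul c d x := by
    change G.map _ _ = G.map _ (G.map _ _)
    rw [map_mkHom_map_mkHom]; simp [k.map_refl]
  smul_zero c := map_zero _
  smul_add c := map_add _
  add_smul c d x := by
    change G.map _ _ = _
    rw [hG.map_add_coeff]; rfl
  zero_smul x := by
    change G.map (mkHom le_rfl 0 1) x = 0
    have := hG.map_add_coeff α 0 0
    rw [add_zero, left_eq_add] at this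
    rw [this]; rfl

def IsDecoratedGrounded.toTowerRep {G : OpCat k ⥤ AddCommGrpCat.{u}}
    (hG : IsDecoratedGrounded G) : TowerRep k :=
  letI := hG.moduleObj
  { V := fun α => G.obj ⟨α⟩
    ν := fun {α β} h =>
      { toFun := G.map (mkHom h 1 1)
        map_add' := map_add _
        map_smul' := fun c x => by
          change G.map _ (G.map _ _) = G.map _ (G.map _ _)
          simp [map_mkHom_map_mkHom] }
    ν_refl := fun α x => by
      change G.map (𝟙 _) x = x
      simp
    ν_ν := fun hαβ hβγ x => by
      change G.map _ (G.map _ _) = G.map _ _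
      simp [map_mkHom_map_mkHom] }

section

variable {G : OpCat k ⥤ AddCommGrpCat.{u}} (hG : IsDecoratedGrounded G)
include hG

theorem IsDecoratedGrounded.isGrounded : TowerRep.IsGrounded k hG.toTowerRep := by
  obtain ⟨α, hα⟩ := hG.exists_ground
  refine ⟨α, fun β h => ?_⟩
  let S := Submodule.span (k.K β) (Set.range (hG.toTowerRep.ν h.le))
  -- The categorical grounding condition is tested on the quotient by the span.
  let q : G.obj ⟨β⟩ ⟶ .of (hG.toTowerRep.V β ⧸ S) :=
    AddCommGrpCat.ofHom (Y := hG.toTowerRep.V β ⧸ S) S.mkQ.toAddMonoidHom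
  have hq : q = 0 := by
    refine hα β h (.of _) _ fun c => ?_
    ext x
    change S.mkQ (G.map (mkHom h.le c 1) x) = 0
    have : G.map (mkHom h.le c 1) x = c • hG.toTowerRep.ν h.le x := by
      change _ = G.map _ (G.map _ _)
      simp [map_mkHom_map_mkHom]
    rw [this, Submodule.mkQ_apply, Submodule.Quotient.mk_eq_zero]
    exact Submodule.smul_mem _ _ (Submodule.subset_span ⟨x, rfl⟩)
  rw [eq_top_iff]
  intro x _
  rw [← Submodule.Quotient.mk_eq_zero]
  exact congrArg (fun t => (ConcreteCategory.hom t) x) hq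

/-- A natural transformation is a morphism of the underlying towers. -/
def IsDecoratedGrounded.toTowerRepHom {H : OpCat k ⥤ AddCommGrpCat.{u}}
    (hH : IsDecoratedGrounded H) (f : G ⟶ H) : hG.toTowerRep ⟶ hH.toTowerRep where
  app α :=
    { toFun := f.app ⟨α⟩
      map_add' := map_add _
      map_smul' c x := NatTrans.naturality_apply f (mkHom (le_refl α) c 1) x }
  naturality h x := NatTrans.naturality_apply f (mkHom h 1 1) x

end

/-- Additivity and vanishing of labels pass to subfunctors by cancelling a monomorphism. Grounding
does not, and comes from `exists_ker_le_span`. -/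
instance : (decoratedGrounded k).IsClosedUnderKernels where
  kernels_le := by
    rintro _ ⟨f, c, hc, hX, hY⟩
    change IsDecoratedGrounded _ at hX hY
    have hmono : Mono c.ι := mono_of_isLimit_fork hc
    refine ⟨fun α a b => ?_, ?_, ?_⟩
    · rw [← cancel_mono (c.ι.app ⟨α⟩)]
      simp [Preadditive.add_comp, hX.map_add_coeff]
    · obtain ⟨S, hS⟩ := hX.exists_labels
      refine ⟨S, fun s hs α => ?_⟩
      rw [← cancel_mono (c.ι.app ⟨α⟩)]
      simp [hS s hs]
    · obtain ⟨α, hα⟩ := TowerRep.exists_ker_le_span hX.isGrounded hY.isGrounded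
        (hX.toTowerRepHom hY f)
      have hinj (a : OpCat k) : Function.Injective (c.ι.app a) :=
        (AddCommGrpCat.mono_iff_injective _).1 inferInstance
      have hcond (a : OpCat k) (y) : f.app a (c.ι.app a y) = 0 :=
        ConcreteCategory.congr_hom (NatTrans.congr_app (KernelFork.condition c) a) y
      have hexact (a : OpCat k) (x) (hx : f.app a x = 0) : ∃ y, c.ι.app a y = x := by
        have hS : (ShortComplex.mk c.ι f c.condition).Exact :=
          ShortComplex.exact_of_f_is_kernel _ (IsLimit.ofIsoLimit hc (Fork.ext (Iso.refl _)))
        exact (ShortComplex.ab_exact_iff _).1 (hS.map ((evaluation _ _).obj a)) x hx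
      refine ⟨α, fun β h Z p hp => ?_⟩
      -- Since `p` is only additive, the induction over the span needs vanishing on every scalar
      -- multiple of `y`.
      have key : ∀ x ∈ Submodule.span (k.K β) (hX.toTowerRep.ν h.le ''
          {y | TowerRep.Hom.app (hX.toTowerRepHom hY f) α y = 0}), ∃ y,
            c.ι.app ⟨β⟩ y = x ∧ ∀ d, p (c.pt.map (mkHom le_rfl d 1) y) = 0 := by
        intro x hx
        induction hx using Submodule.span_induction with
        | mem x hx =>
          obtain ⟨z, hz, rfl⟩ := hx
          obtain ⟨n, rfl⟩ := hexact ⟨α⟩ z hz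
          refine ⟨c.pt.map (mkHom h.le 1 1) n, NatTrans.naturality_apply c.ι _ _, fun d => ?_⟩
          rw [map_mkHom_map_mkHom]
          simpa using congrArg (fun t => t n) (hp d)
        | zero => exact ⟨0, map_zero _, fun d => by simp⟩
        | add x x' _ _ hx hx' =>
          obtain ⟨y, rfl, hy⟩ := hx
          obtain ⟨y', rfl, hy'⟩ := hx'
          exact ⟨y + y', map_add _ _ _, fun d => by simp [hy, hy']⟩
        | smul e x _ hx =>
          obtain ⟨y, rfl, hy⟩ := hx
          refine ⟨c.pt.map (mkHom le_rfl e 1) y, NatTrans.naturality_apply c.ι _ _, fun d => ?_⟩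
          rw [map_mkHom_map_mkHom]
          simpa [k.map_refl] using hy (d * e)
      ext y
      obtain ⟨y', hy', hp'⟩ := key (c.ι.app ⟨β⟩ y) (hα h _ (hcond ⟨β⟩ y))
      obtain rfl := hinj _ hy'
      have h1 := hp' 1
      rw [← id_eq] at h1
      simpa using h1

end OpCat

/-! ### The equivalence between decorated objects and functors satisfying the conditions. -/

namespace SetDecorated

variable {C : Type w} [Category.{v} C] [HasZeroMorphisms C]

theorem hom_ext {X Y : SetDecorated.{u} C} {f g : X ⟶ Y} (h : Hom.hom f = Hom.hom g) : f = g :=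
  Hom.ext h

/-- The action of words in the labels. -/
noncomputable def wordAct (X : SetDecorated.{u} C) : FreeMonoid ZFSet.{u} →* End X.obj :=
  FreeMonoid.lift fun s => X.act s

theorem wordAct_of (X : SetDecorated.{u} C) (s : ZFSet.{u}) :
    X.wordAct (FreeMonoid.of s) = X.act s := rfl

theorem wordAct_comm {X Y : SetDecorated.{u} C} (f : X ⟶ Y) (w : FreeMonoid ZFSet.{u}) :
    X.wordAct w ≫ Hom.hom f = Hom.hom f ≫ Y.wordAct w := by
  induction w using FreeMonoid.recOn with
  | one => simp [End.one_def]
  | of_mul s w hw =>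
    rw [map_mul, map_mul, wordAct_of, wordAct_of, End.mul_def, End.mul_def, Category.assoc,
      Hom.comm_all f, reassoc_of% hw]

end SetDecorated

namespace OpCat

variable {k : FieldTower.{u}}

/-- A set-decorated grounded object as a functor. -/
noncomputable def functorObj (X : SetDecorated.{u} (GroundedRep k)) :
    OpCat k ⥤ AddCommGrpCat.{u} where
  obj a := .of (X.obj.obj.V a.ord)
  map {a b} h := AddCommGrpCat.ofHom
    { toFun x := (Hom.coeff h) • X.obj.obj.ν (Hom.le h) (TowerRep.Hom.app (X.wordAct (Hom.word h)).hom a.ord x)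
      map_zero' := by simp
      map_add' := by simp }
  map_id a := by
    ext x
    change (1 : k.K a.ord) • X.obj.obj.ν _ (TowerRep.Hom.app (X.wordAct 1).hom a.ord x) = x
    rw [map_one, one_smul, X.obj.obj.ν_refl]
    rfl
  map_comp {a b c} f g := by
    ext x
    change ((Hom.coeff g) * k.map (Hom.le g) (Hom.coeff f)) • X.obj.obj.ν _
      (TowerRep.Hom.app (X.wordAct ((Hom.word g) * (Hom.word f))).hom a.ord x) =
      (Hom.coeff g) • X.obj.obj.ν (Hom.le g) (TowerRep.Hom.app (X.wordAct (Hom.word g)).hom b.ord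
        ((Hom.coeff f) • X.obj.obj.ν (Hom.le f) (TowerRep.Hom.app (X.wordAct (Hom.word f)).hom a.ord x)))
    rw [map_mul, map_smul, (X.wordAct (Hom.word g)).hom.naturality, map_smulₛₗ, X.obj.obj.ν_ν, smul_smul]
    rfl

theorem functorObj_map_mkHom (X : SetDecorated.{u} (GroundedRep k)) {α β : Ordinal.{u}} (h : α ≤ β)
    (c : k.K β) (w : FreeMonoid ZFSet.{u}) (x : X.obj.obj.V α) :
    (functorObj X).map (mkHom h c w) x =
      c • X.obj.obj.ν h (TowerRep.Hom.app (X.wordAct w).hom α x) := rfl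

theorem functorObj_map_one (X : SetDecorated.{u} (GroundedRep k)) {α β : Ordinal.{u}} (h : α ≤ β)
    (c : k.K β) (x : X.obj.obj.V α) :
    (functorObj X).map (mkHom h c 1) x = c • X.obj.obj.ν h x := by
  rw [functorObj_map_mkHom, map_one]
  rfl

theorem functorObj_map_of (X : SetDecorated.{u} (GroundedRep k)) {α : Ordinal.{u}}
    (s : ZFSet.{u}) (x : X.obj.obj.V α) :
    (functorObj X).map (mkHom (le_refl α) 1 (.of s)) x = TowerRep.Hom.app (X.act s).hom α x := by
  rw [functorObj_map_mkHom, one_smul, X.obj.obj.ν_refl]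
  rfl

variable (k) in
noncomputable def toFunctor :
    SetDecorated.{u} (GroundedRep k) ⥤ (OpCat k ⥤ AddCommGrpCat.{u}) where
  obj := functorObj
  map {X Y} f :=
    { app a := AddCommGrpCat.ofHom
        (TowerRep.Hom.app (SetDecorated.Hom.hom f).hom a.ord).toAddMonoidHom
      naturality a b h := by
        ext x
        change TowerRep.Hom.app (SetDecorated.Hom.hom f).hom b.ord
          ((Hom.coeff h) • X.obj.obj.ν (Hom.le h) (TowerRep.Hom.app (X.wordAct (Hom.word h)).hom a.ord x)) =
          (Hom.coeff h) • Y.obj.obj.ν (Hom.le h) (TowerRep.Hom.app (Y.wordAct (Hom.word h)).hom a.ord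
            (TowerRep.Hom.app (SetDecorated.Hom.hom f).hom a.ord x))
        rw [map_smul, (SetDecorated.Hom.hom f).hom.naturality]
        have := congrArg (fun t => TowerRep.Hom.app (InducedCategory.Hom.hom t) a.ord x)
          (SetDecorated.wordAct_comm f (Hom.word h))
        exact congrArg (fun t => (Hom.coeff h) • Y.obj.obj.ν (Hom.le h) t) this }

instance : (toFunctor k).Faithful where
  map_injective {X Y f g} h := by
    apply SetDecorated.hom_ext
    ext α x
    exact ConcreteCategory.congr_hom (NatTrans.congr_app h ⟨α⟩) x

/-- Naturality at scalars, at transition maps and at one-letter words gives back linearity,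
compatibility with `ν` and commutation with the labels. -/
instance : (toFunctor k).Full where
  map_surjective {X Y} f := by
    let g : X.obj.obj ⟶ Y.obj.obj :=
      { app := fun α =>
          { toFun := f.app ⟨α⟩
            map_add' := map_add (f.app ⟨α⟩).hom
            map_smul' := fun c x => by
              have h1 := functorObj_map_one X (le_refl α) c x
              have h2 (y) := functorObj_map_one Y (le_refl α) c y
              simp only [TowerRep.ν_refl] at h1 h2
              exact (congrArg (f.app ⟨α⟩) h1).symm.trans ((NatTrans.naturality_apply f _ x).trans (h2 _)) }
        naturality := fun {α β} h x => by
          have h1 := functorObj_map_one X h 1 x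
          have h2 := functorObj_map_one Y h 1 (f.app ⟨α⟩ x)
          rw [one_smul] at h1 h2
          exact (congrArg (f.app ⟨β⟩) h1).symm.trans ((NatTrans.naturality_apply f _ x).trans h2) }
    refine ⟨{ hom := ObjectProperty.homMk g, comm := fun s _ => ?_ }, rfl⟩
    ext α x
    exact (congrArg (f.app ⟨α⟩) (functorObj_map_of X s x)).symm.trans
      ((NatTrans.naturality_apply f _ x).trans (functorObj_map_of Y s (f.app ⟨α⟩ x)))

theorem isDecoratedGrounded_functorObj (X : SetDecorated.{u} (GroundedRep k)) :
    IsDecoratedGrounded (functorObj X) where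
  map_add_coeff α c c' := by
    ext x
    refine (functorObj_map_one X _ _ x).trans ((add_smul (M := X.obj.obj.V α) _ _ _).trans ?_)
    exact congrArg₂ (· + ·) (functorObj_map_one X _ _ x).symm (functorObj_map_one X _ _ x).symm
  exists_labels := by
    refine ⟨X.labels, fun s hs α => ?_⟩
    ext x
    refine (functorObj_map_of X s x).trans ?_
    rw [X.act_of_notMem hs]
    rfl
  exists_ground := by
    obtain ⟨α, hα⟩ := X.obj.property
    refine ⟨α, fun β h Z p hp => ?_⟩
    have key : ∀ x ∈ Submodule.span (k.K β) (Set.range (X.obj.obj.ν h.le)),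
        ∀ d : k.K β, p (d • x : X.obj.obj.V β) = 0 := by
      intro x hx
      induction hx using Submodule.span_induction with
      | mem x hx =>
        obtain ⟨z, rfl⟩ := hx
        intro d
        exact (congrArg p (functorObj_map_one X h.le d z)).symm.trans
          (ConcreteCategory.congr_hom (hp d) z)
      | zero => intro d; rw [smul_zero]; exact map_zero p.hom
      | add x y _ _ hx hy =>
        intro d
        rw [smul_add]
        refine (map_add p.hom _ _).trans ?_
        exact (congrArg₂ (· + ·) (hx d) (hy d)).trans (add_zero 0)
      | smul e x _ hx => intro d; rw [smul_smul]; exact hx _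
    ext x
    rw [hα h] at key
    exact (congrArg p (one_smul (k.K β) (show X.obj.obj.V β from x))).symm.trans (key x trivial 1)

/-- The set-decorated object of a functor that satisfies the three conditions. -/
noncomputable def IsDecoratedGrounded.toSetDecorated {G : OpCat k ⥤ AddCommGrpCat.{u}}
    (hG : IsDecoratedGrounded G) : SetDecorated.{u} (GroundedRep k) where
  obj := ⟨hG.toTowerRep, hG.isGrounded⟩
  labels := hG.exists_labels.choose
  endo s := ObjectProperty.homMk
    { app := fun α =>
        { toFun := G.map (mkHom (le_refl α) 1 (.of s.1))
          map_add' := map_add _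
          map_smul' := fun c x => by
            refine (map_mkHom_map_mkHom _ _ _ _ _ _ G x).trans ?_
            refine Eq.trans ?_ (map_mkHom_map_mkHom _ _ _ _ _ _ G x).symm
            simp [k.map_refl] }
      naturality := fun h x => by
        refine (map_mkHom_map_mkHom _ _ _ _ _ _ G x).trans ?_
        refine Eq.trans ?_ (map_mkHom_map_mkHom _ _ _ _ _ _ G x).symm
        simp }

theorem IsDecoratedGrounded.toSetDecorated_act {G : OpCat k ⥤ AddCommGrpCat.{u}}
    (hG : IsDecoratedGrounded G) (s : ZFSet.{u}) (α : Ordinal.{u}) (x : G.obj ⟨α⟩) :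
    TowerRep.Hom.app (hG.toSetDecorated.act s).hom α x =
      G.map (mkHom (le_refl α) 1 (.of s)) x := by
  by_cases h : s ∈ hG.toSetDecorated.labels
  · rw [SetDecorated.act, dif_pos h]
    rfl
  · rw [SetDecorated.act, dif_neg h, hG.exists_labels.choose_spec s h]
    rfl

theorem IsDecoratedGrounded.toSetDecorated_wordAct {G : OpCat k ⥤ AddCommGrpCat.{u}}
    (hG : IsDecoratedGrounded G) (w : FreeMonoid ZFSet.{u}) (α : Ordinal.{u}) (x : G.obj ⟨α⟩) :
    TowerRep.Hom.app (hG.toSetDecorated.wordAct w).hom α x = G.map (mkHom (le_refl α) 1 w) x := by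
  induction w using FreeMonoid.recOn generalizing x with
  | one =>
    rw [map_one, ← id_eq, G.map_id]
    rfl
  | of_mul s w hw =>
    have h := hG.toSetDecorated_act s α (G.map (mkHom (le_refl α) 1 w) x)
    rw [map_mkHom_map_mkHom, map_one, mul_one] at h
    rw [map_mul, SetDecorated.wordAct_of, ← h, ← hw]
    rfl

/-- The functor of the set-decorated object attached to a functor is the functor itself. -/
noncomputable def IsDecoratedGrounded.functorObjIso {G : OpCat k ⥤ AddCommGrpCat.{u}}
    (hG : IsDecoratedGrounded G) : functorObj hG.toSetDecorated ≅ G :=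
  NatIso.ofComponents (fun a => Iso.refl (G.obj a)) (by
    rintro ⟨α⟩ ⟨β⟩ ⟨h, c, w⟩
    rw [Iso.refl_hom, Iso.refl_hom]
    refine (Category.comp_id _).trans (Eq.trans ?_ (Category.id_comp _).symm)
    ext x
    have h1 := hG.toSetDecorated_wordAct w α x
    change G.map (mkHom le_rfl c 1) (G.map (mkHom h 1 1)
      (TowerRep.Hom.app (hG.toSetDecorated.wordAct w).hom α x)) = G.map (mkHom h c w) x
    refine (map_mkHom_map_mkHom _ _ _ _ _ _ G _).trans ((congrArg _ h1).trans ?_)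
    refine (map_mkHom_map_mkHom _ _ _ _ _ _ G x).trans ?_
    simp)

variable (k) in
noncomputable def toDecoratedGrounded :
    SetDecorated.{u} (GroundedRep k) ⥤ (decoratedGrounded k).FullSubcategory :=
  (decoratedGrounded k).lift (toFunctor k) isDecoratedGrounded_functorObj

instance : (toDecoratedGrounded k).EssSurj where
  mem_essImage G := ⟨IsDecoratedGrounded.toSetDecorated G.property,
    ⟨(decoratedGrounded k).isoMk (IsDecoratedGrounded.functorObjIso G.property)⟩⟩

instance : (toDecoratedGrounded k).Faithful :=
  Functor.Faithful.of_comp_iso (G := (decoratedGrounded k).ι) (H := toFunctor k) (Iso.refl _)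

instance : (toDecoratedGrounded k).Full :=
  Functor.Full.of_comp_faithful_iso (G := (decoratedGrounded k).ι) (H := toFunctor k) (Iso.refl _)

instance : (toDecoratedGrounded k).IsEquivalence where

end OpCat

/-! ### Colimits, abelian structure, AB5 and local smallness. -/

namespace OpCat

variable (k : FieldTower.{u})

theorem hasColimitsOfSize_setDecorated :
    HasColimitsOfSize.{u, u} (SetDecorated.{u} (GroundedRep k)) :=
  have : HasColimitsOfSize.{u, u} (decoratedGrounded k).FullSubcategory :=
    ⟨fun _ _ => inferInstance⟩
  ⟨fun _ _ => Adjunction.hasColimitsOfShape_of_equivalence (toDecoratedGrounded k)⟩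

theorem nonempty_abelian_setDecorated :
    Nonempty (Abelian (SetDecorated.{u} (GroundedRep k))) := by
  let e := (toDecoratedGrounded k).asEquivalence
  let _ : Preadditive (SetDecorated.{u} (GroundedRep k)) :=
    .ofFullyFaithful e.fullyFaithfulFunctor
  have : (toDecoratedGrounded k).Additive := e.fullyFaithfulFunctor.additive_ofFullyFaithful
  have : HasFiniteProducts (SetDecorated.{u} (GroundedRep k)) :=
    ⟨fun n => Adjunction.hasLimitsOfShape_of_equivalence (toDecoratedGrounded k)⟩
  exact ⟨abelianOfEquivalence (toDecoratedGrounded k)⟩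

/-- The embedding into the functor category preserves small colimits and preserves and reflects
finite limits, so exactness of filtered colimits is pulled back from there. -/
theorem ab5OfSize_setDecorated :
    ∃ _ : HasFilteredColimitsOfSize.{u, u} (SetDecorated.{u} (GroundedRep k)),
      AB5OfSize.{u, u} (SetDecorated.{u} (GroundedRep k)) := by
  have := hasColimitsOfSize_setDecorated k
  refine ⟨⟨fun J _ _ => inferInstance⟩, ⟨fun J _ _ => ?_⟩⟩
  let F := toDecoratedGrounded k ⋙ (decoratedGrounded k).ι
  have : HasFiniteLimits (SetDecorated.{u} (GroundedRep k)) :=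
    ⟨fun n _ _ => Adjunction.hasLimitsOfShape_of_equivalence (toDecoratedGrounded k)⟩
  have : PreservesFiniteLimits (decoratedGrounded k).ι := by
    have := (decoratedGrounded k).preservesKernels_ι
    exact Functor.preservesFiniteLimits_of_preservesKernels _
  have : HasExactColimitsOfShape J (OpCat k ⥤ AddCommGrpCat.{u}) := inferInstance
  have : PreservesColimitsOfShape J F := inferInstance
  have : ReflectsFiniteLimits F := inferInstance
  exact HasExactColimitsOfShape.domain_of_functor J F

/-- If the source is grounded at `α`, a morphism is determined by its components at ordinals at most
`α`, which form a small set. -/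
theorem locallySmall_setDecorated : LocallySmall.{u} (SetDecorated.{u} (GroundedRep k)) where
  hom_small X Y := by
    obtain ⟨α, hα⟩ := X.obj.property
    let Φ (f : X ⟶ Y) (β : Set.Iic α) (x : X.obj.obj.V β) : Y.obj.obj.V β :=
      TowerRep.Hom.app (SetDecorated.Hom.hom f).hom β x
    refine small_of_injective (f := Φ) fun f g h => ?_
    apply SetDecorated.hom_ext
    ext β : 2
    have hle (γ : Ordinal.{u}) (hγ : γ ≤ α) (x) := congrFun (congrFun h ⟨γ, hγ⟩) x
    rcases le_or_gt β α with hβ | hβ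
    · exact LinearMap.ext (hle β hβ)
    · refine LinearMap.ext_on (hα hβ) ?_
      rintro _ ⟨x, rfl⟩
      rw [TowerRep.Hom.naturality, TowerRep.Hom.naturality]
      exact congrArg _ (hle α le_rfl x)

end OpCat

/-! ### Shears along an unused label; injective and projective objects. -/

namespace SetDecorated

section Biproduct

variable {C : Type w} [Category.{v} C] [Preadditive C] (X : SetDecorated.{u} C)

/-- By foundation, a set is not a member of itself, so `X.labels` serves as a fresh label. -/
theorem act_labels_self : X.act X.labels = 0 := X.act_of_notMem (ZFSet.mem_irrefl _)

open Classical in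
/-- The endomorphisms of a double of `X` that extend those of `X` on both summands, where the new
label `X.labels` moves the second summand to the first. -/
noncomputable def shearAct (b : BinaryBicone X.obj X.obj) (t : ZFSet.{u}) : b.pt ⟶ b.pt :=
  b.fst ≫ X.act t ≫ b.inl + b.snd ≫ X.act t ≫ b.inr +
    if t = X.labels then b.snd ≫ b.inl else 0

section

variable (b : BinaryBicone X.obj X.obj)

theorem inl_shearAct (t : ZFSet.{u}) : b.inl ≫ X.shearAct b t = X.act t ≫ b.inl := by
  by_cases h : t = X.labels <;> simp [shearAct, h]

theorem shearAct_snd (t : ZFSet.{u}) : X.shearAct b t ≫ b.snd = b.snd ≫ X.act t := by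
  by_cases h : t = X.labels <;> simp [shearAct, h]

theorem shearAct_labels : X.shearAct b X.labels = b.snd ≫ b.inl := by
  simp [shearAct, act_labels_self]

/-- The double of `X` with the operators `shearAct`. -/
noncomputable def shear : SetDecorated.{u} C where
  obj := b.pt
  labels := insert X.labels X.labels
  endo t := X.shearAct b t

theorem shear_act (t : ZFSet.{u}) : (X.shear b).act t = X.shearAct b t := by
  by_cases h : t ∈ (X.shear b).labels
  · exact dif_pos h
  · have h' : ¬ (t = X.labels ∨ t ∈ X.labels) := fun h' => h (ZFSet.mem_insert_iff.2 h')
    rw [not_or] at h'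
    have h0 : X.shearAct b t = 0 := by simp [shearAct, h'.1, X.act_of_notMem h'.2]
    rw [act_of_notMem _ h, h0]
    rfl

noncomputable def shearInl : X ⟶ X.shear b where
  hom := b.inl
  comm t _ := by rw [shear_act]; exact (X.inl_shearAct b t).symm

noncomputable def shearSnd : X.shear b ⟶ X where
  hom := b.snd
  comm t _ := by rw [shear_act]; exact X.shearAct_snd b t

instance : Mono (X.shearInl b) where
  right_cancellation f g h := by
    have h1 : Hom.hom f ≫ b.inl = Hom.hom g ≫ b.inl := congrArg Hom.hom h
    apply hom_ext
    simpa using congrArg (fun t => t ≫ b.fst) h1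

instance : Epi (X.shearSnd b) where
  left_cancellation f g h := by
    have h1 : b.snd ≫ Hom.hom f = b.snd ≫ Hom.hom g := congrArg Hom.hom h
    apply hom_ext
    simpa using congrArg (fun t => b.inr ≫ t) h1

end

theorem isZero_of_id_obj_eq_zero (h : 𝟙 X.obj = 0) : IsZero X where
  unique_to Y := ⟨⟨⟨⟨0, fun s _ => by simp⟩⟩, fun f => hom_ext (by
    rw [← Category.id_comp (Hom.hom f), h, zero_comp]; rfl)⟩⟩
  unique_from Y := ⟨⟨⟨⟨0, fun s _ => by simp⟩⟩, fun f => hom_ext (by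
    rw [← Category.comp_id (Hom.hom f), h, comp_zero]; rfl)⟩⟩

variable {X}

/-- A retraction `ρ` of `shearInl` commutes with the fresh label, which acts by `b.snd ≫ b.inl` on
the double and by zero on `X`. Hence `b.snd = b.snd ≫ b.inl ≫ ρ = 0`. -/
theorem isZero_of_injective (b : BinaryBicone X.obj X.obj) (hX : Injective X) : IsZero X := by
  apply isZero_of_id_obj_eq_zero
  let r := Injective.factorThru (𝟙 X) (X.shearInl b)
  let ρ : b.pt ⟶ X.obj := Hom.hom r
  have h1 : b.inl ≫ ρ = 𝟙 X.obj :=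
    congrArg Hom.hom (Injective.comp_factorThru (𝟙 X) (X.shearInl b))
  have h2 : X.shearAct b X.labels ≫ ρ = ρ ≫ X.act X.labels := by
    rw [← shear_act]
    exact Hom.comm_all r X.labels
  rw [shearAct_labels, act_labels_self, comp_zero, Category.assoc, h1, Category.comp_id] at h2
  rw [← b.inr_snd, h2, comp_zero]

/-- Dually, a section `ρ` of `shearSnd` gives `b.inl = ρ ≫ b.snd ≫ b.inl = 0`. -/
theorem isZero_of_projective (b : BinaryBicone X.obj X.obj) (hX : Projective X) : IsZero X := by
  apply isZero_of_id_obj_eq_zero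
  let σ := Projective.factorThru (𝟙 X) (X.shearSnd b)
  let ρ : X.obj ⟶ b.pt := Hom.hom σ
  have h1 : ρ ≫ b.snd = 𝟙 X.obj :=
    congrArg Hom.hom (Projective.factorThru_comp (𝟙 X) (X.shearSnd b))
  have h2 : X.act X.labels ≫ ρ = ρ ≫ X.shearAct b X.labels := by
    rw [← shear_act]
    exact Hom.comm_all σ X.labels
  rw [shearAct_labels, act_labels_self, zero_comp, reassoc_of% h1] at h2
  rw [← b.inl_fst, ← h2, zero_comp]

end Biproduct

end SetDecorated

/-! ### Binary products of grounded towers. -/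

namespace TowerRep

variable {k : FieldTower.{u}}

/-- The levelwise product of two towers. -/
def prod (X Y : TowerRep k) : TowerRep k where
  V α := X.V α × Y.V α
  ν h :=
    { toFun x := (X.ν h x.1, Y.ν h x.2)
      map_add' _ _ := by simp
      map_smul' _ _ := by simp }
  ν_refl α x := by simp [ν_refl]
  ν_ν _ _ x := by simp [ν_ν]

theorem IsGroundedAt.prod {X Y : TowerRep k} {α : Ordinal.{u}} (hX : X.IsGroundedAt α)
    (hY : Y.IsGroundedAt α) : (X.prod Y).IsGroundedAt α := by
  intro β h
  let S : Submodule (k.K β) (X.V β × Y.V β) :=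
    Submodule.span (k.K β) (Set.range ((X.prod Y).ν h.le))
  have h1 : Submodule.span (k.K β) (Set.range (X.ν h.le)) ≤
      S.comap (LinearMap.inl (k.K β) (X.V β) (Y.V β)) := by
    rw [Submodule.span_le]
    rintro _ ⟨x, rfl⟩
    exact Submodule.subset_span ⟨(x, 0), Prod.ext rfl (map_zero (Y.ν h.le))⟩
  have h2 : Submodule.span (k.K β) (Set.range (Y.ν h.le)) ≤
      S.comap (LinearMap.inr (k.K β) (X.V β) (Y.V β)) := by
    rw [Submodule.span_le]
    rintro _ ⟨y, rfl⟩
    exact Submodule.subset_span ⟨(0, y), Prod.ext (map_zero (X.ν h.le)) rfl⟩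
  rw [hX h] at h1
  rw [hY h] at h2
  refine eq_top_iff.2 fun x _ => ?_
  have := S.add_mem (h1 (x := x.1) trivial) (h2 (x := x.2) trivial)
  rw [LinearMap.inl_apply, LinearMap.inr_apply, Prod.mk_add_mk, add_zero, zero_add] at this
  exact this

theorem IsGrounded.prod {X Y : TowerRep k} (hX : IsGrounded k X) (hY : IsGrounded k Y) :
    IsGrounded k (X.prod Y) := by
  obtain ⟨α, hα⟩ := hX
  obtain ⟨β, hβ⟩ := hY
  exact ⟨max α β, (hα.mono (le_max_left _ _)).prod (hβ.mono (le_max_right _ _))⟩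

/-- The levelwise product of two grounded objects, with its projections and inclusions. -/
def prodBicone (X Y : GroundedRep k) : BinaryBicone X Y where
  pt := ⟨X.obj.prod Y.obj, X.property.prod Y.property⟩
  fst := ObjectProperty.homMk ⟨fun _ => LinearMap.fst _ _ _, fun _ _ => rfl⟩
  snd := ObjectProperty.homMk ⟨fun _ => LinearMap.snd _ _ _, fun _ _ => rfl⟩
  inl := ObjectProperty.homMk ⟨fun _ => LinearMap.inl _ _ _,
    fun h _ => Prod.ext rfl (map_zero (Y.obj.ν h)).symm⟩
  inr := ObjectProperty.homMk ⟨fun _ => LinearMap.inr _ _ _,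
    fun h _ => Prod.ext (map_zero (X.obj.ν h)).symm rfl⟩
  inl_fst := rfl
  inl_snd := rfl
  inr_fst := rfl
  inr_snd := rfl

/-! ### Towers freely generated at one stage, and the failure of countable products. -/

/-- The tower that is `k.K γ` at the ordinals `γ ≥ β` and zero below. -/
def unitFrom (k : FieldTower.{u}) (β : Ordinal.{u}) : TowerRep k where
  -- This submodule is everything if `β ≤ γ` and zero otherwise, without a case split on types.
  V γ := ({ carrier := {x | x ≠ 0 → β ≤ γ}
            add_mem' := fun {x y} hx hy h => by
              by_cases h' : x = 0
              · exact hy (by simpa [h'] using h)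
              · exact hx h'
            zero_mem' := fun h => (h rfl).elim
            smul_mem' := fun c x hx h => hx (right_ne_zero_of_smul h) } :
          Submodule (k.K γ) (k.K γ))
  ν {γ δ} h :=
    { toFun x := ⟨k.map h x.1, fun hx => (x.2 (by rintro h0; simp [h0] at hx)).trans h⟩
      map_add' x y := by ext; simp
      map_smul' c x := by ext; simp }
  ν_refl γ x := Subtype.ext (k.map_refl γ _)
  ν_ν _ _ x := Subtype.ext (k.map_map _ _ _)

theorem isGroundedAt_unitFrom (k : FieldTower.{u}) (β : Ordinal.{u}) :
    (unitFrom k β).IsGroundedAt β := by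
  intro γ h
  refine eq_top_iff.2 fun x _ => ?_
  have : x = x.1 • (unitFrom k β).ν h.le ⟨1, fun _ => le_rfl⟩ :=
    Subtype.ext (by change x.1 = x.1 * k.map h.le 1; simp)
  rw [this]
  exact Submodule.smul_mem _ _ (Submodule.subset_span ⟨_, rfl⟩)

open Classical in
/-- The morphism from `unitFrom k β` that corresponds to an element at level `β`. -/
noncomputable def unitFromDesc {Y : TowerRep k} {β : Ordinal.{u}} (y : Y.V β) :
    unitFrom k β ⟶ Y where
  app γ := if h : β ≤ γ then
    (LinearMap.toSpanSingleton (k.K γ) (Y.V γ) (Y.ν h y)).comp (Submodule.subtype _) else 0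
  naturality {γ δ} h x := by
    by_cases hγ : β ≤ γ
    · rw [dif_pos hγ, dif_pos (hγ.trans h)]
      change k.map h x.1 • Y.ν _ y = Y.ν h (x.1 • Y.ν hγ y)
      rw [map_smulₛₗ, Y.ν_ν]
    · have hx : x = 0 := Subtype.ext (by_contra fun hx => hγ (x.2 hx))
      simp [hx]

theorem unitFromDesc_app_one {Y : TowerRep k} {β : Ordinal.{u}} (y : Y.V β) :
    Hom.app (unitFromDesc y) β ⟨1, fun _ => le_rfl⟩ = y := by
  change (dite _ _ _ : unitFrom k β |>.V β →ₗ[k.K β] Y.V β) _ = y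
  rw [dif_pos le_rfl]
  change (1 : k.K β) • Y.ν _ y = y
  rw [one_smul, Y.ν_refl]

end TowerRep

/-- An object with the empty set of labels. -/
noncomputable def SetDecorated.ofObj {C : Type w} [Category.{v} C] (c : C) :
    SetDecorated.{u} C where
  obj := c
  labels := ∅
  endo s := (ZFSet.notMem_empty s.1 s.2).elim

theorem FieldTower.IsInfinite.exists_linearIndependent {k : FieldTower.{u}} (hk : k.IsInfinite)
    {α β : Ordinal.{u}} (h : α < β) :
    letI := (k.map h.le).toAlgebra
    ∃ e : ℕ → k.K β, LinearIndependent (k.K α) e := by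
  let := (k.map h.le).toAlgebra
  let b := Module.Basis.ofVectorSpace (k.K α) (k.K β)
  have : Infinite (Module.Basis.ofVectorSpaceIndex (k.K α) (k.K β)) := by
    by_contra hfin
    rw [not_infinite_iff_finite] at hfin
    exact hk h (Module.Finite.of_basis b)
  exact ⟨_, b.linearIndependent.comp _ (Infinite.natEmbedding _).injective⟩

theorem not_hasProductsOfShape_nat (k : FieldTower.{u}) (hk : k.IsInfinite) :
    ¬ HasProductsOfShape ℕ (SetDecorated.{u} (GroundedRep k)) := by
  intro hprod
  let U (β : Ordinal.{u}) : SetDecorated.{u} (GroundedRep k) :=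
    .ofObj ⟨TowerRep.unitFrom k β, β, TowerRep.isGroundedAt_unitFrom k β⟩
  let P := ∏ᶜ fun _ : ℕ => U 0
  obtain ⟨α, hα⟩ := P.obj.property
  let β := Order.succ α
  have h : α < β := Order.lt_succ α
  let := (k.map h.le).toAlgebra
  obtain ⟨e, he⟩ := hk.exists_linearIndependent h
  let g (i : ℕ) : U β ⟶ U 0 :=
    { hom := ObjectProperty.homMk (TowerRep.unitFromDesc (Y := TowerRep.unitFrom k 0)
        ⟨e i, fun _ => zero_le⟩)
      comm := fun s hs => by
        rcases ZFSet.mem_union.1 hs with hs | hs <;> exact (ZFSet.notMem_empty _ hs).elim }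
  let π (i : ℕ) (γ : Ordinal.{u}) : P.obj.obj.V γ →ₗ[k.K γ] (TowerRep.unitFrom k 0).V γ :=
    TowerRep.Hom.app (SetDecorated.Hom.hom (Pi.π (fun _ : ℕ => U 0) i)).hom γ
  -- The maps `g i` pick out the elements `e i`, so `p` is an element of the product at stage `β`
  -- with these coordinates.
  let p : P.obj.obj.V β :=
    TowerRep.Hom.app (SetDecorated.Hom.hom (Pi.lift g)).hom β ⟨1, fun _ => le_rfl⟩
  have hp (i : ℕ) : (π i β p).1 = e i := by
    have h1 := congrArg (fun t : U β ⟶ U 0 => TowerRep.Hom.app (SetDecorated.Hom.hom t).hom β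
      ⟨1, fun _ => le_rfl⟩) (Pi.lift_π g i)
    exact congrArg Subtype.val (h1.trans (TowerRep.unitFromDesc_app_one _))
  have key : ∀ x ∈ Submodule.span (k.K β) (Set.range (P.obj.obj.ν h.le)),
      ∃ F : Submodule (k.K α) (k.K β), F.FG ∧ ∀ i, (π i β x).1 ∈ F := by
    intro x hx
    induction hx using Submodule.span_induction with
    | mem x hx =>
      obtain ⟨z, rfl⟩ := hx
      -- The coordinates of an element coming from stage `α` lie in the image of `k.K α`, the line
      -- spanned by `1`.
      refine ⟨Submodule.span _ {1}, Submodule.fg_span_singleton _, fun i => ?_⟩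
      refine Submodule.mem_span_singleton.2 ⟨(π i α z).1, ?_⟩
      rw [Algebra.smul_def, mul_one]
      exact (congrArg Subtype.val 
        (TowerRep.Hom.naturality (SetDecorated.Hom.hom (Pi.π (fun _ : ℕ => U 0) i)).hom h.le z)).symm
    | zero => exact ⟨⊥, Submodule.fg_bot, fun i => by
        rw [map_zero]; exact zero_mem _⟩
    | add x y _ _ hx hy =>
      obtain ⟨F, hF, hx⟩ := hx
      obtain ⟨F', hF', hy⟩ := hy
      refine ⟨F ⊔ F', hF.sup hF', fun i => ?_⟩
      rw [map_add]
      exact Submodule.add_mem_sup (hx i) (hy i)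
    | smul c x _ hx =>
      obtain ⟨F, hF, hx⟩ := hx
      refine ⟨F.map (LinearMap.mulLeft (k.K α) c), hF.map _, fun i => ?_⟩
      rw [map_smul]
      exact ⟨_, hx i, rfl⟩
  obtain ⟨F, hF, hF'⟩ := key p (by rw [hα h]; trivial)
  have : Module.Finite (k.K α) F := Module.Finite.iff_fg.2 hF
  have hli : LinearIndependent (k.K α) fun i => (⟨e i, hp i ▸ hF' i⟩ : F) :=
    LinearIndependent.of_comp F.subtype he
  exact not_finite_iff_infinite.2 inferInstance hli.finite

/-- Smallness is measured in the universe `u` throughout: the ordinals `Ordinal.{u}` form a proper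
class, while the fields, vector spaces, label sets and shapes of (co)limits are `u`-small. -/
theorem mainTheorem1 (k : FieldTower.{u}) (hk : k.IsInfinite) :
    -- an abelian category, whose hom-sets are sets
    Nonempty (Abelian (SetDecorated.{u} (GroundedRep k))) ∧
    LocallySmall.{u} (SetDecorated.{u} (GroundedRep k)) ∧
    -- AB5: cocomplete, with exact filtered colimits
    HasColimitsOfSize.{u, u} (SetDecorated.{u} (GroundedRep k)) ∧
    (∃ _ : HasFilteredColimitsOfSize.{u, u} (SetDecorated.{u} (GroundedRep k)),
      AB5OfSize.{u, u} (SetDecorated.{u} (GroundedRep k))) ∧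
    -- no countable products
    ¬ HasProductsOfShape ℕ (SetDecorated.{u} (GroundedRep k)) ∧
    -- every injective object and every projective object is zero
    (∀ X : SetDecorated.{u} (GroundedRep k), Injective X → IsZero X) ∧
    (∀ X : SetDecorated.{u} (GroundedRep k), Projective X → IsZero X) :=
  ⟨OpCat.nonempty_abelian_setDecorated k, OpCat.locallySmall_setDecorated k,
    OpCat.hasColimitsOfSize_setDecorated k, OpCat.ab5OfSize_setDecorated k,
    not_hasProductsOfShape_nat k hk,
    fun X => SetDecorated.isZero_of_injective (TowerRep.prodBicone X.obj X.obj),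
    fun X => SetDecorated.isZero_of_projective (TowerRep.prodBicone X.obj X.obj)⟩
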